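/- Let $\mathfrak P=\mathbb P(V)$ be the projective space of a finite-dimensional vector space $V$ over a field $K$ of characteristic $\neq 2$, let $T,B$ be two disjoint (possibly empty) projective subspaces of $\mathfrak P$, and let $Q$ be a nondegenerate quadric on $B$ which is ruled, i.e. contains a projective line. Let $S_0$ be the projective cone with vertex $T$ over $Q$ (the union of all joins of $T$ with a point of $Q$), and let $S=S_0\setminus T$ be the point set of the generalized Laguerre space $\mathfrak L$. Let $\mathcal L$ be the set of all nonempty intersections with $S$ of the lines of $\mathfrak P$ that lie on $S_0$; let $\mathcal G\subset\mathcal L$ (*projective lines*) be the set of the lines of $\mathfrak P$ that lie on $S_0$ and miss $T$, and let $\mathcal A\subset\mathcal L$ (*affine lines*) be the set of the nonempty intersections with $S$ of the lines of $\mathfrak P$ that lie on $S_0$ and meet $T$. The index of a quadric is the projective dimension of its maximal generators, i.e. of the projective subspaces of maximal dimension contained in it. Among the sections $S\cap A$ of $S$ with projective subspaces $A$ of dimension $3$ we consider the following: * $\mathfrak l^0_{2,1}$ (*Minkowski planes contained in $\mathfrak L$*): the sections that are a nondegenerate $2$-dimensional quadric of index $1$ in $A$; * $\mathfrak d^1_{1,0}$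 (*projective cones*): the sections that are a projective cone whose vertex is a point and whose base is a nondegenerate $1$-dimensional quadric of index $0$ (a nondegenerate conic with points) in a plane of $A$ missing the vertex; * $\mathfrak l^1_{1,0}$ (*affine cones*, or Laguerre planes): the sections that are such a cone with its vertex deleted, where the deleted vertex is a point of $T$. Then for every set $Y$ of points of $\mathfrak P$, in particular for every $1$-dimensional subspace $Y$ of $\mathfrak L$ (a line or a conic), $$Y\in\mathcal G\iff Y\in\mathcal L\ \wedge\ (\exists Z\in\mathfrak l^0_{2,1})\,[Y\subset Z],\qquad\qquad Y\in\mathcal A\iff Y\in\mathcal L\ \wedge\ Y\notin\mathcal G;$$ and for every set $Z$ of points of $\mathfrak P$, in particular for every $2$-dimensional subspace $Z$ of $\mathfrak L$, $$Z\in\mathfrak d^1_{1,0}\iff Z\in\mathfrak d^1_{1,0}\cup\mathfrak l^1_{1,0}\ \wedge\ (\exists Y\in\mathcal G)\,[Y\subset Z],\qquad\qquad Z\in\mathfrak l^1_{1,0}\iff Z\in\mathfrak d^1_{1,0}\cup\mathfrak l^1_{1,0}\ \wedge\ Z\notin\mathfrak d^1_{1,0}.$$ -/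

import Mathlib

open scoped LinearAlgebra.Projectivization

namespace Laguerre

variable {K V : Type*} [Field K] [AddCommGroup V] [Module K V]

/-- The points of the projective subspace of `ℙ K V` given by the linear subspace `U`. A projective
subspace of dimension `k` is given by a linear subspace of dimension `k + 1`. -/
def pts (U : Submodule K V) : Set (ℙ K V) := {p | p.submodule ≤ U}

/-- The points of `ℙ K V`, lying in the projective subspace `D`, at which the form `q` vanishes. -/
def zeroPoints {D : Submodule K V} (q : QuadraticForm K D) : Set (ℙ K V) :=
  {p | ∃ x : D, q x = 0 ∧ p.submodule = Submodule.span K {(x : V)}}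

/-- The quadric of `q` has index `w`: its maximal generators (projective subspaces contained in it)
have projective dimension `w`. -/
def HasIndex {W : Type*} [AddCommGroup W] [Module K W] (q : QuadraticForm K W) (w : ℕ) : Prop :=
  (∃ U : Submodule K W, Module.finrank K U = w + 1 ∧ ∀ x ∈ U, q x = 0) ∧
    ∀ U : Submodule K W, (∀ x ∈ U, q x = 0) → Module.finrank K U ≤ w + 1

/-- `X` is a nondegenerate `d`-dimensional quadric of index `w` in the projective subspace `D`
(which therefore has projective dimension `d + 1`). -/
def IsQuadric (D : Submodule K V) (d w : ℕ) (X : Set (ℙ K V)) : Prop :=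
  Module.finrank K D = d + 2 ∧
    ∃ q : QuadraticForm K D, q.Nondegenerate ∧ HasIndex q w ∧ X = zeroPoints q

/-- The projective cone with vertex the projective subspace `N` over the point set `X`: the union of
`N` and of all the joins of `N` with a point of `X`. -/
def cone (N : Submodule K V) (X : Set (ℙ K V)) : Set (ℙ K V) :=
  {p | p.submodule ≤ N ∨ ∃ x ∈ X, p.submodule ≤ N ⊔ x.submodule}

end Laguerre

open Laguerre

/-- A generalized Laguerre space in the projective space `ℙ K V`: it is determined by two skew
projective subspaces `T`, `B` and by a nondegenerate ruled quadric (a quadric that contains a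
projective line) on `B`, given by a quadratic form. -/
structure LaguerreSpace (K V : Type*) [Field K] [AddCommGroup V] [Module K V] where
  T : Submodule K V
  B : Submodule K V
  disjoint : Disjoint T B
  form : QuadraticForm K B
  nondegenerate : form.Nondegenerate
  ruled : ∃ U : Submodule K B, Module.finrank K U = 2 ∧ ∀ x ∈ U, form x = 0

namespace LaguerreSpace

variable {K V : Type*} [Field K] [AddCommGroup V] [Module K V] (L : LaguerreSpace K V)

/-- The projective cone `S₀` with vertex `T` over the base quadric. -/
def S₀ : Set (ℙ K V) := cone L.T (zeroPoints L.form)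

/-- The point set `S = S₀ \ T` of the Laguerre space. -/
def S : Set (ℙ K V) := L.S₀ \ pts L.T

/-- The family `𝓛` of lines: nonempty sections with `S` of the projective lines lying on `S₀`. -/
def lines : Set (Set (ℙ K V)) :=
  {Y | ∃ U : Submodule K V, Module.finrank K U = 2 ∧ pts U ⊆ L.S₀ ∧
    Y = pts U ∩ L.S ∧ Y.Nonempty}

/-- The family `𝓖` of projective lines: those lines on `S₀` that miss `T`. -/
def projLines : Set (Set (ℙ K V)) :=
  {Y | ∃ U : Submodule K V, Module.finrank K U = 2 ∧ pts U ⊆ L.S₀ ∧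
    pts U ∩ pts L.T = ∅ ∧ Y = pts U}

/-- The family `𝓐` of affine lines: nonempty sections with `S` of the projective lines lying on
`S₀` that meet `T`. -/
def affLines : Set (Set (ℙ K V)) :=
  {Y | ∃ U : Submodule K V, Module.finrank K U = 2 ∧ pts U ⊆ L.S₀ ∧
    (pts U ∩ pts L.T).Nonempty ∧ Y = pts U ∩ L.S ∧ Y.Nonempty}

/-- The family `𝔰^{m,m'}_{d,w}` of the affine cones contained in the Laguerre space, with
`m`-dimensional affine generator, defined over a projective cone with `m'`-dimensional projective
generator, whose basis is a `d`-dimensional quadric of index `w`.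
Here `N ≤ T` is the (deleted) vertex of the affine cone, of projective dimension `m - 1`; `M` is the
vertex of the projective cone, of projective dimension `m' - w - 1`; the basis `Q` lies in `D`.
That the cone is contained in the Laguerre space as a subspace means that it is the section of `S`
with the projective subspace spanned by `N`, `M`, `D`. -/
def coneFamily (m m' d w : ℕ) : Set (Set (ℙ K V)) :=
  {X | ∃ (N M D : Submodule K V) (Q : Set (ℙ K V)),
    N ≤ L.T ∧ Disjoint N M ∧ Disjoint (N ⊔ M) D ∧
    Module.finrank K N = m ∧ Module.finrank K M + w = m' ∧ IsQuadric D d w Q ∧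
    X = cone N (cone M Q) \ pts N ∧ X = L.S ∩ pts (N ⊔ M ⊔ D)}

/-- The family `𝔩^m_{d,w}` of the affine cones contained in the Laguerre space with `m`-dimensional
affine generator over a `d`-dimensional quadric of index `w`. -/
def affConeFamily (m d w : ℕ) : Set (Set (ℙ K V)) := L.coneFamily m w d w

/-- The family `𝔡^m_{d,w}` of the projective cones contained in the Laguerre space with
`m`-dimensional projective generator over a `d`-dimensional quadric of index `w`. -/
def projConeFamily (m d w : ℕ) : Set (Set (ℙ K V)) := L.coneFamily 0 m d w

/-- Minkowski planes contained in the Laguerre space: `2`-dimensional subquadrics of index `1`. -/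
def minkowskiPlanes : Set (Set (ℙ K V)) := L.affConeFamily 0 2 1

/-- Two-dimensional affine cones (Laguerre planes) contained in the Laguerre space. -/
def affCones : Set (Set (ℙ K V)) := L.affConeFamily 1 1 0

/-- Two-dimensional projective cones contained in the Laguerre space. -/
def projCones : Set (Set (ℙ K V)) := L.projConeFamily 1 1 0

end LaguerreSpace

/-! The lines split disjointly into projective and affine ones, so everything rests on four
containment facts. A projective line projects from `T` onto a line of the base quadric. Its two
basis vectors complete to two hyperbolic pairs, whose span cuts `S` in a Minkowski plane
(`exists_minkowskiPlane`). An affine line lies in no Minkowski plane: since `2 ≠ 0`, a quadric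
containing it also contains its point on `T`, which `S` omits (`affLine_not_subset_minkowskiPlane`).
A projective cone contains its own generators (`exists_projLine_subset`). An affine cone contains no
projective line, since projection from the deleted vertex would put a line on a conic of index `0`
(`projLine_not_subset_affCone`). -/

namespace Laguerre

/-! ### Points, zero sets and cones in terms of vectors -/

section Points

variable {K V : Type*} [Field K] [AddCommGroup V] [Module K V]

theorem mk_mem_pts {U : Submodule K V} {v : V} (hv : v ≠ 0) :
    Projectivization.mk K v hv ∈ pts U ↔ v ∈ U := by
  simp [pts, Projectivization.submodule_mk]

theorem mk_mem_zeroPoints {D : Submodule K V} {q : QuadraticForm K D} {v : V} (hv : v ≠ 0) :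
    Projectivization.mk K v hv ∈ zeroPoints q ↔ ∃ d : D, q d = 0 ∧ (d : V) = v := by
  simp only [zeroPoints, Set.mem_ofPred_eq, Projectivization.submodule_mk]
  constructor
  · rintro ⟨x, hx, h⟩
    obtain ⟨c, hc⟩ := Submodule.mem_span_singleton.1 (h ▸ Submodule.mem_span_singleton_self v)
    exact ⟨c • x, by simp [QuadraticMap.map_smul, hx], by simpa using hc⟩
  · rintro ⟨d, hd, rfl⟩
    exact ⟨d, hd, rfl⟩

theorem cone_bot (X : Set (ℙ K V)) : cone (⊥ : Submodule K V) X = X := by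
  ext p
  have hp : p.submodule ≠ ⊥ := by
    rw [Projectivization.submodule_eq, Ne, Submodule.span_singleton_eq_bot]
    exact p.rep_nonzero
  simp only [cone, Set.mem_ofPred_eq, bot_sup_eq, le_bot_iff, hp, false_or]
  constructor
  · rintro ⟨x, hx, h⟩
    have hrank := Submodule.eq_of_le_of_finrank_eq h
      (by rw [p.finrank_submodule, x.finrank_submodule])
    rwa [Projectivization.submodule_injective hrank]
  · exact fun h => ⟨p, h, le_rfl⟩

theorem pts_bot : pts (⊥ : Submodule K V) = ∅ := by
  ext p
  induction p with
  | h v hv => simpa [mk_mem_pts] using hv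

/-- Allowing `d = 0` absorbs the points of the vertex into the same formula. -/
theorem mk_mem_cone {N D : Submodule K V} {q : QuadraticForm K D} {v : V} (hv : v ≠ 0) :
    Projectivization.mk K v hv ∈ cone N (zeroPoints q) ↔
      ∃ n ∈ N, ∃ d : D, q d = 0 ∧ n + d = v := by
  constructor
  · rintro (h | ⟨x, hx, h⟩)
    · exact ⟨v, (mk_mem_pts hv).1 h, 0, by simp, by simp⟩
    · induction x with
      | h x hx0 =>
        obtain ⟨d, hd, rfl⟩ := (mk_mem_zeroPoints hx0).1 hx
        rw [Projectivization.submodule_mk, Projectivization.submodule_mk,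
          Submodule.span_singleton_le_iff_mem] at h
        obtain ⟨n, hn, y, hy, rfl⟩ := Submodule.mem_sup.1 h
        obtain ⟨c, rfl⟩ := Submodule.mem_span_singleton.1 hy
        exact ⟨n, hn, c • d, by simp [QuadraticMap.map_smul, hd], by simp⟩
  · rintro ⟨n, hn, d, hd, rfl⟩
    by_cases hd0 : (d : V) = 0
    · left
      simpa [Projectivization.submodule_mk, hd0] using hn
    · right
      refine ⟨Projectivization.mk K (d : V) hd0, (mk_mem_zeroPoints hd0).2 ⟨d, hd, rfl⟩, ?_⟩
      rw [Projectivization.submodule_mk, Projectivization.submodule_mk,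
        Submodule.span_singleton_le_iff_mem]
      exact Submodule.add_mem_sup hn (Submodule.mem_span_singleton_self _)

end Points

/-! ### Hyperbolic pairs and totally singular subspaces -/

section Hyperbolic

variable {K V : Type*} [Field K] [AddCommGroup V] [Module K V]

/-- The vectors `u₁, f₁` and `u₂, f₂` are two orthogonal hyperbolic pairs for `F`. -/
structure IsHyperbolic (F : QuadraticForm K V) (u₁ u₂ f₁ f₂ : V) : Prop where
  map_u₁ : F u₁ = 0
  map_u₂ : F u₂ = 0
  map_f₁ : F f₁ = 0
  map_f₂ : F f₂ = 0
  u₁_u₂ : F.polarBilin u₁ u₂ = 0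
  u₁_f₁ : F.polarBilin u₁ f₁ = 1
  u₁_f₂ : F.polarBilin u₁ f₂ = 0
  u₂_f₁ : F.polarBilin u₂ f₁ = 0
  u₂_f₂ : F.polarBilin u₂ f₂ = 1
  f₁_f₂ : F.polarBilin f₁ f₂ = 0

theorem polarBilin_comm (F : QuadraticForm K V) (x y : V) :
    F.polarBilin x y = F.polarBilin y x := by
  simp [QuadraticMap.polar_comm]

theorem polarBilin_self_eq_zero (F : QuadraticForm K V) {x : V} (hx : F x = 0) :
    F.polarBilin x x = 0 := by
  simp [hx]

theorem polarBilin_eq_zero_of_isotropic (F : QuadraticForm K V) {U : Submodule K V}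
    (hU : ∀ x ∈ U, F x = 0) {x y : V} (hx : x ∈ U) (hy : y ∈ U) : F.polarBilin x y = 0 := by
  simp [QuadraticMap.polar, hU x hx, hU y hy, hU _ (U.add_mem hx hy)]

/-- A totally singular `U` lies in its own orthogonal complement, which has complementary dimension.
-/
theorem finrank_isotropic_le [FiniteDimensional K V] (hK : (2 : K) ≠ 0) {q : QuadraticForm K V}
    (hq : q.Nondegenerate) {U : Submodule K V} (hU : ∀ x ∈ U, q x = 0) :
    2 * Module.finrank K U ≤ Module.finrank K V := by
  have : Invertible (2 : K) := invertibleOfNonzero hK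
  have hn := QuadraticMap.nondegenerate_polar_iff.2 hq
  have hle : U ≤ LinearMap.BilinForm.orthogonal q.polarBilin U := by
    intro x hx y hy
    exact polarBilin_eq_zero_of_isotropic q hU hy hx
  have h1 := Submodule.finrank_mono hle
  rw [LinearMap.BilinForm.finrank_orthogonal hn] at h1
  have := Submodule.finrank_le U
  omega

variable {F : QuadraticForm K V} {u₁ u₂ f₁ f₂ : V}

theorem IsHyperbolic.coeff (h : IsHyperbolic F u₁ u₂ f₁ f₂) (a b c d : K) :
    F.polarBilin (a • u₁ + b • u₂ + c • f₁ + d • f₂) f₁ = a ∧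
    F.polarBilin (a • u₁ + b • u₂ + c • f₁ + d • f₂) f₂ = b ∧
    F.polarBilin (a • u₁ + b • u₂ + c • f₁ + d • f₂) u₁ = c ∧
    F.polarBilin (a • u₁ + b • u₂ + c • f₁ + d • f₂) u₂ = d := by
  have e1 := polarBilin_self_eq_zero F h.map_u₁
  have e2 := polarBilin_self_eq_zero F h.map_u₂
  have e3 := polarBilin_self_eq_zero F h.map_f₁
  have e4 := polarBilin_self_eq_zero F h.map_f₂
  have c1 := polarBilin_comm F u₂ u₁
  have c2 := polarBilin_comm F f₁ u₁
  have c3 := polarBilin_comm F f₁ u₂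
  have c4 := polarBilin_comm F f₂ u₁
  have c5 := polarBilin_comm F f₂ u₂
  have c6 := polarBilin_comm F f₂ f₁
  simp only [map_add, map_smul, LinearMap.add_apply, LinearMap.smul_apply, smul_eq_mul,
    e1, e2, e3, e4, c1, c2, c3, c4, c5, c6, h.u₁_u₂, h.u₁_f₁, h.u₁_f₂, h.u₂_f₁, h.u₂_f₂, h.f₁_f₂]
  simp

theorem IsHyperbolic.finrank_span (h : IsHyperbolic F u₁ u₂ f₁ f₂) :
    Module.finrank K (Submodule.span K (Set.range ![u₁, u₂, f₁, f₂])) = 4 := by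
  have hli : LinearIndependent K ![u₁, u₂, f₁, f₂] := by
    rw [Fintype.linearIndependent_iff]
    intro g hg
    simp only [Fin.sum_univ_four] at hg
    have hc := h.coeff (g 0) (g 1) (g 2) (g 3)
    have hg' : g 0 • u₁ + g 1 • u₂ + g 2 • f₁ + g 3 • f₂ = 0 := by simpa using hg
    simp only [hg', map_zero, LinearMap.zero_apply] at hc
    obtain ⟨h0, h1, h2, h3⟩ := hc
    intro i
    fin_cases i
    exacts [h0.symm, h1.symm, h2.symm, h3.symm]
  simpa using finrank_span_eq_card hli

theorem IsHyperbolic.eq_zero (h : IsHyperbolic F u₁ u₂ f₁ f₂) {x : V}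
    (hx : x ∈ Submodule.span K (Set.range ![u₁, u₂, f₁, f₂]))
    (hx0 : ∀ y ∈ Submodule.span K (Set.range ![u₁, u₂, f₁, f₂]), F.polarBilin x y = 0) :
    x = 0 := by
  obtain ⟨g, hg⟩ := (Submodule.mem_span_range_iff_exists_fun K).1 hx
  simp only [Fin.sum_univ_four] at hg
  have hg' : g 0 • u₁ + g 1 • u₂ + g 2 • f₁ + g 3 • f₂ = x := by simpa using hg
  have hc := h.coeff (g 0) (g 1) (g 2) (g 3)
  have hm (i : Fin 4) : F.polarBilin x (![u₁, u₂, f₁, f₂] i) = 0 :=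
    hx0 _ (Submodule.subset_span ⟨i, rfl⟩)
  have h0 : F.polarBilin x u₁ = 0 := hm 0
  have h1 : F.polarBilin x u₂ = 0 := hm 1
  have h2 : F.polarBilin x f₁ = 0 := hm 2
  have h3 : F.polarBilin x f₂ = 0 := hm 3
  rw [hg', h0, h1, h2, h3] at hc
  rw [← hg', ← hc.1, ← hc.2.1, ← hc.2.2.1, ← hc.2.2.2]
  simp

theorem IsHyperbolic.isQuadric [FiniteDimensional K V] (hK : (2 : K) ≠ 0)
    (h : IsHyperbolic F u₁ u₂ f₁ f₂) {U : Submodule K V}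
    (hU : Module.finrank K U = 2) (hF : ∀ x ∈ U, F x = 0)
    (hUD : U ≤ Submodule.span K (Set.range ![u₁, u₂, f₁, f₂])) :
    IsQuadric (Submodule.span K (Set.range ![u₁, u₂, f₁, f₂])) 2 1
      (zeroPoints (F.comp (Submodule.span K (Set.range ![u₁, u₂, f₁, f₂])).subtype)) := by
  set D := Submodule.span K (Set.range ![u₁, u₂, f₁, f₂]) with hD
  have hfr : Module.finrank K D = 4 := h.finrank_span
  have : Invertible (2 : K) := invertibleOfNonzero hK
  have hq : (F.comp D.subtype).Nondegenerate := by
    rw [QuadraticMap.nondegenerate_iff_radical_eq_bot, QuadraticMap.radical_eq_ker_polarBilin,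
      Submodule.eq_bot_iff]
    intro x hx
    have hx' := LinearMap.mem_ker.1 hx
    refine Subtype.ext (h.eq_zero x.2 fun y hy => ?_)
    have := LinearMap.congr_fun hx' ⟨y, hy⟩
    simpa [QuadraticMap.polar] using this
  refine ⟨hfr, _, hq, ⟨⟨U.comap D.subtype, ?_, ?_⟩, ?_⟩, rfl⟩
  · rw [(Submodule.comapSubtypeEquivOfLe hUD).finrank_eq, hU]
  · intro x hx
    exact hF _ hx
  · intro U' hU'
    have := finrank_isotropic_le hK hq hU'
    omega

/-- Two vectors spanning a totally isotropic subspace extend to two orthogonal hyperbolic pairs. -/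
theorem exists_isHyperbolic [FiniteDimensional K V] (hK : (2 : K) ≠ 0) (hF : F.Nondegenerate)
    {e₁ e₂ : V} (he : LinearIndependent K ![e₁, e₂]) (h₁ : F e₁ = 0) (h₂ : F e₂ = 0)
    (h₁₂ : F.polarBilin e₁ e₂ = 0) : ∃ f₁ f₂, IsHyperbolic F e₁ e₂ f₁ f₂ := by
  have : Invertible (2 : K) := invertibleOfNonzero hK
  have hn := QuadraticMap.nondegenerate_polar_iff.2 hF
  -- A functional prescribed on `e₁`, `e₂` extends to `V` and is represented by a vector, the polar
  -- form being nondegenerate.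
  have key (a : Fin 2 → K) : ∃ g, F.polarBilin e₁ g = a 0 ∧ F.polarBilin e₂ g = a 1 := by
    obtain ⟨φ, hφ⟩ := ((Module.Basis.span he).constr K a).exists_extend
    have hφ' (i : Fin 2) : φ (![e₁, e₂] i) = a i := by
      have := LinearMap.congr_fun hφ (Module.Basis.span he i)
      rw [Module.Basis.constr_basis] at this
      simpa [Module.Basis.span_apply] using this
    refine ⟨(LinearMap.BilinForm.toDual F.polarBilin hn).symm φ, ?_, ?_⟩
    · rw [polarBilin_comm]
      exact (LinearMap.BilinForm.apply_toDual_symm_apply φ e₁).trans (hφ' 0)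
    · rw [polarBilin_comm]
      exact (LinearMap.BilinForm.apply_toDual_symm_apply φ e₂).trans (hφ' 1)
  obtain ⟨g₁, a1, a2⟩ := key ![1, 0]
  obtain ⟨g₂, b1, b2⟩ := key ![0, 1]
  simp only [Matrix.cons_val_zero, Matrix.cons_val_one] at a1 a2 b1 b2
  have e1 := polarBilin_self_eq_zero F h₁
  have e2 := polarBilin_self_eq_zero F h₂
  have add_sub_smul (g e : V) (c : K) (hee : F e = 0) :
      F (g - c • e) = F g - c * F.polarBilin e g := by
    rw [sub_eq_add_neg, ← neg_smul, QuadraticMap.map_add F, QuadraticMap.map_smul, hee,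
      QuadraticMap.polar_smul_right, QuadraticMap.polar_comm]
    simp [sub_eq_add_neg]
  -- Since `e₁` is singular and pairs to `1` with `g₁`, this multiple of `e₁` cancels `F g₁`. The
  -- same correction turns `g₂` into `g₃`.
  set f₁ := g₁ - F g₁ • e₁ with hf₁
  set c := F.polarBilin f₁ g₂ with hc
  have x11 : F.polarBilin e₁ f₁ = 1 := by simp only [hf₁, map_sub, map_smul, e1, a1]; simp
  have x21 : F.polarBilin e₂ f₁ = 0 := by
    simp only [hf₁, map_sub, map_smul, polarBilin_comm F e₂ e₁, h₁₂, a2]; simp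
  set g₃ := g₂ - F g₂ • e₂ with hg₃
  have y1 : F.polarBilin e₁ g₃ = 0 := by simp only [hg₃, map_sub, map_smul, h₁₂, b1]; simp
  have y2 : F.polarBilin e₂ g₃ = 1 := by simp only [hg₃, map_sub, map_smul, e2, b2]; simp
  have y3 : F.polarBilin f₁ g₃ = c := by
    simp only [hg₃, map_sub, map_smul, polarBilin_comm F f₁ e₂, x21, hc]; simp
  -- Subtracting `c • e₁` makes the second partner orthogonal to `f₁`; it stays singular because
  -- `g₃` is orthogonal to `e₁`.
  refine ⟨f₁, g₃ - c • e₁, h₁, h₂, ?_, ?_, h₁₂, x11, ?_, x21, ?_, ?_⟩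
  · rw [hf₁, add_sub_smul _ _ _ h₁, a1]; simp
  · rw [add_sub_smul _ _ _ h₁, y1, hg₃, add_sub_smul _ _ _ h₂, b2]; simp
  · simp only [map_sub, map_smul, y1, e1]; simp
  · simp only [map_sub, map_smul, y2, polarBilin_comm F e₂ e₁, h₁₂]; simp
  · simp only [map_sub, map_smul, y3, polarBilin_comm F f₁ e₁, x11]; simp

end Hyperbolic

end Laguerre

/-! ### Projective and affine lines -/

namespace LaguerreSpace

variable {K V : Type*} [Field K] [AddCommGroup V] [Module K V] {L : LaguerreSpace K V}

theorem mk_mem_S₀ {v : V} (hv : v ≠ 0) : Projectivization.mk K v hv ∈ L.S₀ ↔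
    ∃ t ∈ L.T, ∃ d : L.B, L.form d = 0 ∧ t + d = v :=
  mk_mem_cone hv

theorem mk_mem_S {v : V} (hv : v ≠ 0) : Projectivization.mk K v hv ∈ L.S ↔
    (∃ t ∈ L.T, ∃ d : L.B, L.form d = 0 ∧ t + d = v) ∧ v ∉ L.T := by
  rw [S, Set.mem_sdiff, mk_mem_S₀, mk_mem_pts]

/-- Used to pull the base form back to a form on `V` whose radical contains `T`. -/
theorem exists_projection (L : LaguerreSpace K V) :
    ∃ P : V →ₗ[K] L.B, (∀ b : L.B, P b = b) ∧ ∀ t ∈ L.T, P t = 0 := by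
  obtain ⟨C, hTC, hC⟩ := L.disjoint.exists_isCompl
  refine ⟨Submodule.projectionOnto L.B C hC.symm,
    fun b => Submodule.projectionOnto_apply_left hC.symm b, fun t ht => ?_⟩
  exact (Submodule.projectionOnto_apply_eq_zero_iff hC.symm).2 (hTC ht)

theorem projLines_subset_lines : L.projLines ⊆ L.lines := by
  rintro _ ⟨U, hU, hS, hT, rfl⟩
  refine ⟨U, hU, hS, ?_, ?_⟩
  · ext p
    refine ⟨fun hp => ⟨hp, hS hp, fun hpT => ?_⟩, fun hp => hp.1⟩
    exact (Set.eq_empty_iff_forall_notMem.1 hT) p ⟨hp, hpT⟩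
  · have hne : U ≠ ⊥ := by
      rintro rfl
      simp at hU
    obtain ⟨x, hx, hx0⟩ := Submodule.exists_mem_ne_zero_of_ne_bot hne
    exact ⟨_, (mk_mem_pts hx0).2 hx⟩

theorem affLines_subset_lines : L.affLines ⊆ L.lines :=
  fun _ ⟨U, hU, hS, _, hY⟩ => ⟨U, hU, hS, hY⟩

theorem mem_lines_iff {Y : Set (ℙ K V)} : Y ∈ L.lines ↔ Y ∈ L.projLines ∨ Y ∈ L.affLines := by
  constructor
  · rintro ⟨U, hU, hS, rfl, hne⟩
    by_cases hT : pts U ∩ pts L.T = ∅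
    · refine Or.inl ⟨U, hU, hS, hT, ?_⟩
      ext p
      refine ⟨fun hp => hp.1, fun hp => ⟨hp, hS hp, fun hpT => ?_⟩⟩
      exact (Set.eq_empty_iff_forall_notMem.1 hT) p ⟨hp, hpT⟩
    · exact Or.inr ⟨U, hU, hS, Set.nonempty_iff_ne_empty.2 hT, rfl, hne⟩
  · rintro (h | h)
    exacts [projLines_subset_lines h, affLines_subset_lines h]

theorem disjoint_of_inter_pts_eq_empty {U W : Submodule K V} (h : pts U ∩ pts W = ∅) :
    Disjoint U W := by
  rw [Submodule.disjoint_def]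
  intro x hx hxT
  by_contra hx0
  exact (Set.eq_empty_iff_forall_notMem.1 h) _ ⟨(mk_mem_pts hx0).2 hx, (mk_mem_pts hx0).2 hxT⟩

/-- A subspace containing the points on `S` of a line on `S₀` contains the whole line. -/
theorem le_of_inter_S_subset {U D : Submodule K V} (hS : pts U ⊆ L.S₀)
    (hne : (pts U ∩ L.S).Nonempty) (h : pts U ∩ L.S ⊆ pts D) : U ≤ D := by
  have hmem : ∀ x ∈ U, x ∉ L.T → x ∈ D := by
    intro x hx hxT
    have hx0 : x ≠ 0 := fun h0 => hxT (h0 ▸ L.T.zero_mem)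
    exact (mk_mem_pts hx0).1 (h ⟨(mk_mem_pts hx0).2 hx, hS ((mk_mem_pts hx0).2 hx),
      fun h' => hxT ((mk_mem_pts hx0).1 h')⟩)
  obtain ⟨p, hpU, -, hpT⟩ := hne
  induction p with
  | h v hv =>
    rw [mk_mem_pts] at hpU hpT
    intro x hx
    by_cases hxT : x ∈ L.T
    · have hxv := hmem (x + v) (U.add_mem hx hpU) fun h' => hpT ((L.T.add_mem_iff_right hxT).1 h')
      exact (D.add_mem_iff_left (hmem v hpU hpT)).1 hxv
    · exact hmem x hx hxT

theorem affLines_disjoint_projLines {Y : Set (ℙ K V)} (hA : Y ∈ L.affLines) :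
    Y ∉ L.projLines := by
  obtain ⟨U, hU, hS, ⟨p, hpU, hpT⟩, hY, hne⟩ := hA
  rintro ⟨U', hU', hS', hT', hY'⟩
  have hle : U ≤ U' := le_of_inter_S_subset hS (hY ▸ hne) (by rw [← hY, hY'])
  exact (Set.eq_empty_iff_forall_notMem.1 hT') p ⟨hpU.trans hle, hpT⟩

/-! ### Minkowski planes and the lines they contain -/

variable [FiniteDimensional K V]

theorem mem_minkowskiPlanes_iff {Z : Set (ℙ K V)} : Z ∈ L.minkowskiPlanes ↔
    ∃ D : Submodule K V, IsQuadric D 2 1 Z ∧ Z = L.S ∩ pts D := by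
  constructor
  · rintro ⟨N, M, D, Q, -, -, -, hN, hM, hQ, h1, h2⟩
    obtain rfl : N = ⊥ := Submodule.finrank_eq_zero.1 hN
    obtain rfl : M = ⊥ := Submodule.finrank_eq_zero.1 (by omega)
    rw [cone_bot, cone_bot, pts_bot, Set.sdiff_empty] at h1
    subst h1
    exact ⟨D, hQ, by simpa using h2⟩
  · rintro ⟨D, hQ, h⟩
    exact ⟨⊥, ⊥, D, Z, by simp, by simp, by simp, by simp, by simp, hQ,
      by rw [cone_bot, cone_bot, pts_bot, Set.sdiff_empty], by simpa using h⟩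

theorem mem_projCones_iff {Z : Set (ℙ K V)} : Z ∈ L.projCones ↔
    ∃ (M D : Submodule K V) (Q : Set (ℙ K V)), Disjoint M D ∧ Module.finrank K M = 1 ∧
      IsQuadric D 1 0 Q ∧ Z = cone M Q ∧ Z = L.S ∩ pts (M ⊔ D) := by
  constructor
  · rintro ⟨N, M, D, Q, -, -, hD, hN, hM, hQ, h1, h2⟩
    obtain rfl : N = ⊥ := Submodule.finrank_eq_zero.1 hN
    rw [cone_bot, pts_bot, Set.sdiff_empty] at h1
    exact ⟨M, D, Q, by simpa using hD, hM, hQ, h1, by simpa using h2⟩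
  · rintro ⟨M, D, Q, hD, hM, hQ, h1, h2⟩
    exact ⟨⊥, M, D, Q, by simp, by simp, by simpa using hD, by simp, hM, hQ,
      by rw [cone_bot, pts_bot, Set.sdiff_empty, h1], by simpa using h2⟩

theorem exists_minkowskiPlane (hK : (2 : K) ≠ 0) {Y : Set (ℙ K V)} (hY : Y ∈ L.projLines) :
    ∃ Z ∈ L.minkowskiPlanes, Y ⊆ Z := by
  obtain ⟨U, hU, hS, hT, rfl⟩ := hY
  have hdis := disjoint_of_inter_pts_eq_empty hT
  obtain ⟨P, hPB, hPT⟩ := L.exists_projection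
  have hdec : ∀ x ∈ U, x - P x ∈ L.T ∧ L.form (P x) = 0 := by
    intro x hx
    by_cases hx0 : x = 0
    · simp [hx0]
    · obtain ⟨t, ht, d, hd, rfl⟩ := (mk_mem_S₀ hx0).1 (hS ((mk_mem_pts hx0).2 hx))
      simp [hPB, hPT t ht, ht, hd]
  let F : QuadraticForm K V := L.form.comp P
  have hF : ∀ x ∈ U, F x = 0 := fun x hx => (hdec x hx).2
  let b := Module.finBasisOfFinrankEq K U hU
  have hPU : LinearMap.ker (P.comp U.subtype) = ⊥ := by
    rw [Submodule.eq_bot_iff]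
    intro x hx
    have hx' : P (x : V) = 0 := hx
    have := (hdec x x.2).1
    rw [hx', Submodule.coe_zero, sub_zero] at this
    exact Subtype.ext (Submodule.disjoint_def.1 hdis x x.2 this)
  have hli : LinearIndependent K ![P (b 0), P (b 1)] := by
    have hfun : ![P (b 0), P (b 1)] = P.comp U.subtype ∘ b := by
      funext i
      fin_cases i <;> rfl
    rw [hfun]
    exact b.linearIndependent.map' _ hPU
  have hpol (x y : V) : F.polarBilin x y = L.form.polarBilin (P x) (P y) := by
    simp [F, QuadraticMap.polar]
  -- The partners are found in `L.B`, where the form is nondegenerate; `F` itself may be degenerate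
  -- along `T`.
  obtain ⟨f₁, f₂, h⟩ := exists_isHyperbolic hK L.nondegenerate hli (hF _ (b 0).2) (hF _ (b 1).2)
    ((hpol _ _).symm.trans (polarBilin_eq_zero_of_isotropic F hF (b 0).2 (b 1).2))
  have hh : IsHyperbolic F (b 0 : V) (b 1 : V) (f₁ : V) (f₂ : V) := by
    obtain ⟨h1, h2, h3, h4, h5, h6, h7, h8, h9, h10⟩ := h
    constructor <;> simpa only [hpol, hPB, F, QuadraticMap.comp_apply]
  set D := Submodule.span K (Set.range ![(b 0 : V), (b 1 : V), (f₁ : V), (f₂ : V)]) with hD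
  have hUD : U ≤ D := by
    intro x hx
    have hsum := b.sum_repr ⟨x, hx⟩
    rw [Fin.sum_univ_two] at hsum
    have hx' : x = b.repr ⟨x, hx⟩ 0 • (b 0 : V) + b.repr ⟨x, hx⟩ 1 • (b 1 : V) := by
      simpa using (congrArg Subtype.val hsum).symm
    rw [hx']
    exact D.add_mem (D.smul_mem _ (Submodule.subset_span ⟨0, rfl⟩))
      (D.smul_mem _ (Submodule.subset_span ⟨1, rfl⟩))
  -- `T` lies in the radical of `F`, while `F` is nondegenerate on `D`.
  have hDT : ∀ x ∈ D, x ∈ L.T → x = 0 := by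
    intro x hx hxT
    refine hh.eq_zero hx fun y _ => ?_
    rw [hpol, hPT x hxT]
    simp
  have hDW : ∀ x ∈ D, x - P x ∈ L.T := by
    have hle : D ≤ L.T.comap (LinearMap.id - L.B.subtype.comp P) := by
      rw [hD, Submodule.span_le]
      rintro _ ⟨i, rfl⟩
      fin_cases i
      · exact (hdec _ (b 0).2).1
      · exact (hdec _ (b 1).2).1
      · simp [hPB]
      · simp [hPB]
    exact fun x hx => hle hx
  have hZ : zeroPoints (F.comp D.subtype) = L.S ∩ pts D := by
    ext p
    induction p with
    | h v hv =>
      rw [Set.mem_inter_iff, mk_mem_zeroPoints, mk_mem_S, mk_mem_pts]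
      constructor
      · rintro ⟨d, hd, rfl⟩
        exact ⟨⟨⟨_, hDW d d.2, P d, hd, by simp⟩, fun hT => hv (hDT d d.2 hT)⟩, d.2⟩
      · rintro ⟨⟨⟨t, ht, d, hd, rfl⟩, -⟩, hvD⟩
        exact ⟨⟨_, hvD⟩, by simp [F, hPT t ht, hPB, hd], rfl⟩
  refine ⟨L.S ∩ pts D, mem_minkowskiPlanes_iff.2
    ⟨D, hZ ▸ hh.isQuadric hK hU hF hUD, rfl⟩, fun p hp => ⟨⟨hS hp, fun hpT => ?_⟩, hp.trans hUD⟩⟩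
  exact (Set.eq_empty_iff_forall_notMem.1 hT) p ⟨hp, hpT⟩

theorem affLine_not_subset_minkowskiPlane (hK : (2 : K) ≠ 0) {Y Z : Set (ℙ K V)}
    (hY : Y ∈ L.affLines) (hZ : Z ∈ L.minkowskiPlanes) : ¬ Y ⊆ Z := by
  intro hYZ
  obtain ⟨U, hU, hS, ⟨p, hpU, hpT⟩, rfl, hne⟩ := hY
  obtain ⟨D, ⟨-, q, -, -, hq⟩, hZS⟩ := mem_minkowskiPlanes_iff.1 hZ
  have hUD : U ≤ D := le_of_inter_S_subset hS hne (hYZ.trans (by rw [hZS]; exact fun _ h => h.2))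
  have hzero (x : D) (hx : (x : V) ∈ U) (hxT : (x : V) ∉ L.T) : q x = 0 := by
    have hx0 : (x : V) ≠ 0 := fun h0 => hxT (h0 ▸ L.T.zero_mem)
    have hxZ : Projectivization.mk K (x : V) hx0 ∈ Z := hYZ ⟨(mk_mem_pts hx0).2 hx,
      hS ((mk_mem_pts hx0).2 hx), fun h' => hxT ((mk_mem_pts hx0).1 h')⟩
    rw [hq] at hxZ
    obtain ⟨d, hd, hdx⟩ := (mk_mem_zeroPoints hx0).1 hxZ
    rwa [← Subtype.ext hdx]
  obtain ⟨r, hrU, -, hrT⟩ := hne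
  induction p with
  | h t ht =>
    induction r with
    | h v hv =>
      rw [mk_mem_pts] at hpU hpT hrU hrT
      set t' : D := ⟨t, hUD hpU⟩
      set v' : D := ⟨v, hUD hrU⟩
      have h1 : q v' = 0 := hzero v' hrU hrT
      have h2 : q (v' + t') = 0 := hzero _ (U.add_mem hrU hpU)
        fun h' => hrT ((L.T.add_mem_iff_left hpT).1 h')
      have h3 : q (v' - t') = 0 := hzero _ (U.sub_mem hrU hpU)
        fun h' => hrT ((L.T.sub_mem_iff_left hpT).1 h')
      rw [QuadraticMap.map_add q] at h2
      rw [sub_eq_add_neg, QuadraticMap.map_add q, QuadraticMap.map_neg,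
        QuadraticMap.polar_neg_right] at h3
      -- The second difference of `q` along `v' - t'`, `v'`, `v' + t'`, all of which lie off `T`.
      have h4 : 2 * q t' = 0 := by linear_combination h2 + h3 - 2 * h1
      have h5 : q t' = 0 := (mul_eq_zero.1 h4).resolve_left hK
      have htZ : Projectivization.mk K t ht ∈ Z := by
        rw [hq]
        exact (mk_mem_zeroPoints ht).2 ⟨t', h5, rfl⟩
      rw [hZS] at htZ
      exact htZ.1.2 ((mk_mem_pts ht).2 hpT)

/-! ### Projective and affine cones -/

/-- Index `0` provides a point on the base conic. Its join with the vertex lies in `Z ⊆ S`, hence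
misses `T`. -/
theorem exists_projLine_subset {Z : Set (ℙ K V)} (hZ : Z ∈ L.projCones) :
    ∃ Y ∈ L.projLines, Y ⊆ Z := by
  obtain ⟨M, D, Q, hMD, hM, ⟨-, q, -, ⟨⟨U, hU, hUq⟩, -⟩, rfl⟩, hZ, hZS⟩ := mem_projCones_iff.1 hZ
  have hUrank : Module.finrank K (U.map D.subtype) = 1 := by
    rw [Submodule.finrank_map_subtype_eq, hU]
  have hUD : U.map D.subtype ≤ D := Submodule.map_subtype_le D U
  have hsub : pts (M ⊔ U.map D.subtype) ⊆ Z := by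
    intro p hp
    rw [hZ]
    induction p with
    | h v hv =>
      obtain ⟨m, hm, _, ⟨u, hu, rfl⟩, rfl⟩ := Submodule.mem_sup.1 ((mk_mem_pts hv).1 hp)
      exact (mk_mem_cone hv).2 ⟨m, hm, u, hUq u hu, rfl⟩
  refine ⟨_, ⟨M ⊔ U.map D.subtype, ?_, ?_, ?_, rfl⟩, hsub⟩
  · have := Submodule.finrank_sup_add_finrank_inf_eq M (U.map D.subtype)
    rw [(hMD.mono_right hUD).eq_bot, finrank_bot] at this
    omega
  · exact fun p hp => (hZS ▸ hsub hp).1.1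
  · rw [Set.eq_empty_iff_forall_notMem]
    rintro p ⟨hp, hpT⟩
    exact (hZS ▸ hsub hp).1.2 hpT

theorem projLine_not_subset_affCone {Y Z : Set (ℙ K V)} (hY : Y ∈ L.projLines)
    (hZ : Z ∈ L.affCones) : ¬ Y ⊆ Z := by
  intro hYZ
  obtain ⟨U, hU, hS, hT, rfl⟩ := hY
  obtain ⟨N, M, D, Q, hNT, -, hND, hN, hM, ⟨-, q, -, ⟨-, hq⟩, rfl⟩, hZ, -⟩ := hZ
  obtain rfl : M = ⊥ := Submodule.finrank_eq_zero.1 (by omega)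
  rw [cone_bot] at hZ
  rw [sup_bot_eq] at hND
  have hUN : Disjoint U N := (disjoint_of_inter_pts_eq_empty hT).mono_right hNT
  obtain ⟨C, hNC, hC⟩ := hND.exists_isCompl
  let P := Submodule.projectionOnto D C hC.symm
  have hPD (d : D) : P d = d := Submodule.projectionOnto_apply_left hC.symm d
  have hPN : ∀ n ∈ N, P n = 0 := fun n hn =>
    (Submodule.projectionOnto_apply_eq_zero_iff hC.symm).2 (hNC hn)
  have hdec : ∀ x ∈ U, x - P x ∈ N ∧ q (P x) = 0 := by
    intro x hx
    by_cases hx0 : x = 0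
    · simp [hx0]
    · have hxZ := hYZ ((mk_mem_pts hx0).2 hx)
      rw [hZ] at hxZ
      obtain ⟨n, hn, d, hd, rfl⟩ := (mk_mem_cone hx0).1 hxZ.1
      simp [hPD, hPN n hn, hn, hd]
  -- The kernel lies in `U ∩ N`, which is zero because `N ≤ T`. The image is then a totally singular
  -- subspace of dimension `2` in `D`.
  have hinj : Function.Injective (P.comp U.subtype) := by
    rw [← LinearMap.ker_eq_bot, Submodule.eq_bot_iff]
    intro x hx
    have hx' : P (x : V) = 0 := hx
    have := (hdec x x.2).1
    rw [hx', Submodule.coe_zero, sub_zero] at this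
    exact Subtype.ext (Submodule.disjoint_def.1 hUN x x.2 this)
  have hrank := hq (LinearMap.range (P.comp U.subtype)) (by
    rintro _ ⟨x, rfl⟩
    exact (hdec x x.2).2)
  rw [LinearMap.finrank_range_of_inj hinj, hU] at hrank
  omega

end LaguerreSpace

theorem mainTheorem10 {K V : Type*} [Field K] (hK : (2 : K) ≠ 0) [AddCommGroup V] [Module K V]
    [FiniteDimensional K V] (L : LaguerreSpace K V) :
    (∀ Y : Set (ℙ K V),
      (Y ∈ L.projLines ↔ Y ∈ L.lines ∧ ∃ Z ∈ L.minkowskiPlanes, Y ⊆ Z) ∧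
      (Y ∈ L.affLines ↔ Y ∈ L.lines ∧ Y ∉ L.projLines)) ∧
    (∀ Z : Set (ℙ K V),
      (Z ∈ L.projCones ↔ Z ∈ L.projCones ∪ L.affCones ∧ ∃ Y ∈ L.projLines, Y ⊆ Z) ∧
      (Z ∈ L.affCones ↔ Z ∈ L.projCones ∪ L.affCones ∧ Z ∉ L.projCones)) := by
  refine ⟨fun Y => ⟨⟨fun h => ?_, ?_⟩, ⟨fun h => ?_, ?_⟩⟩,
    fun Z => ⟨⟨fun h => ?_, ?_⟩, ⟨fun h => ?_, ?_⟩⟩⟩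
  · exact ⟨LaguerreSpace.projLines_subset_lines h, LaguerreSpace.exists_minkowskiPlane hK h⟩
  · rintro ⟨h, Z, hZ, hYZ⟩
    exact (LaguerreSpace.mem_lines_iff.1 h).resolve_right fun hA =>
      LaguerreSpace.affLine_not_subset_minkowskiPlane hK hA hZ hYZ
  · exact ⟨LaguerreSpace.affLines_subset_lines h, LaguerreSpace.affLines_disjoint_projLines h⟩
  · exact fun h => (LaguerreSpace.mem_lines_iff.1 h.1).resolve_left h.2
  · exact ⟨Or.inl h, LaguerreSpace.exists_projLine_subset h⟩
  · rintro ⟨h, Y, hY, hYZ⟩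
    exact h.resolve_right fun hA => LaguerreSpace.projLine_not_subset_affCone hY hA hYZ
  · refine ⟨Or.inr h, fun hp => ?_⟩
    obtain ⟨Y, hY, hYZ⟩ := LaguerreSpace.exists_projLine_subset hp
    exact LaguerreSpace.projLine_not_subset_affCone hY h hYZ
  · exact fun h => h.1.resolve_left h.2
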